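/- Let $0<b<a$ be real numbers, let $\mathsf A=\{(x_1,x_2)\in\mathbb R^2 : x_1^2/a^2+x_2^2/b^2<1\}$ be the elliptical disc with semi-axes $a$ and $b$, and let $\varepsilon=\sqrt{1-b^2/a^2}$ be its eccentricity. For a real charge density $\sigma$ on $\mathsf A$ let $$f_\sigma(x)=\frac1{4\pi}\int_{\mathsf A}\frac{\sigma(y)}{|x-y|}\,dy\quad(x\in\mathsf A),\qquad I_\sigma=\int_{\mathsf A}f_\sigma(x)\,\sigma(x)\,dx$$ be its electrostatic potential and its electrostatic energy, and let $$K(\varepsilon)=\int_0^{\pi/2}\frac{d\phi}{\sqrt{1-\varepsilon^2\sin^2\phi}},\qquad E(\varepsilon)=\int_0^{\pi/2}\sqrt{1-\varepsilon^2\sin^2\phi}\,d\phi$$ be the complete elliptic integrals of the first and second kind. Let $\alpha_0,\alpha_1,\alpha_2\in\mathbb R$ and $\sigma(x)=\alpha_0+\alpha_1x_1/a+\alpha_2x_2/b$. Then the integral defining $f_\sigma(x)$ converges absolutely for every $x\in\mathsf A$, the double integral below converges absolutely, and $$I_\sigma=\frac1{4\pi}\iint_{\mathsf A\times\mathsf A}\frac{\sigma(x)\sigma(y)}{|x-y|}\,dx\,dy=\frac{8ab^2}{15\pi}\left[(5\alpha_0^2+\alpha_2^2)K(\varepsilon)+(\alpha_1^2-\alpha_2^2)\frac{K(\varepsilon)-E(\varepsilon)}{\varepsilon^2}\right].$$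 Moreover, with $\sigma_0=1$, $\sigma_1=x_1/a$ and $\sigma_2=x_2/b$, the cross terms vanish, that is $\int_{\mathsf A}f_{\sigma_i}(x)\sigma_j(x)\,dx=0$ for $i\ne j$, and $$I_{\sigma_0}=\frac{8}{3\pi}ab^2K(\varepsilon),\qquad I_{\sigma_1}=\frac{8}{15\pi}ab^2\,\frac{K(\varepsilon)-E(\varepsilon)}{\varepsilon^2},\qquad I_{\sigma_2}=\frac{8}{15\pi}ab^2\left(K(\varepsilon)-\frac{K(\varepsilon)-E(\varepsilon)}{\varepsilon^2}\right).$$ -/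

import Mathlib

open MeasureTheory

noncomputable section

namespace EllipticDisc

/-- The Euclidean plane; its `volume` is two-dimensional Lebesgue measure. -/
abbrev Plane : Type := EuclideanSpace ℝ (Fin 2)

/-- The open elliptical disc with semi-axes `a` and `b` along the coordinate axes. -/
def disc (a b : ℝ) : Set Plane :=
  {x | x 0 ^ 2 / a ^ 2 + x 1 ^ 2 / b ^ 2 - 1 < 0}

/-- The eccentricity `√(1 - b²/a²)`. -/
def eccentricity (a b : ℝ) : ℝ := Real.sqrt (1 - b ^ 2 / a ^ 2)

/-- The complete elliptic integral of the first kind, as a function of the modulus. -/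
def ellipticK (ε : ℝ) : ℝ :=
  ∫ φ in (0 : ℝ)..(Real.pi / 2), 1 / Real.sqrt (1 - ε ^ 2 * Real.sin φ ^ 2)

/-- The complete elliptic integral of the second kind, as a function of the modulus. -/
def ellipticE (ε : ℝ) : ℝ :=
  ∫ φ in (0 : ℝ)..(Real.pi / 2), Real.sqrt (1 - ε ^ 2 * Real.sin φ ^ 2)

/-- The electrostatic potential at `x` of the charge density `σ` on the disc. -/
def potential (a b : ℝ) (σ : Plane → ℝ) (x : Plane) : ℝ :=
  1 / (4 * Real.pi) * ∫ y in disc a b, σ y / ‖x - y‖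

/-- The mutual electrostatic energy of two real charge densities on the disc. -/
def mutualEnergy (a b : ℝ) (σ τ : Plane → ℝ) : ℝ :=
  ∫ x in disc a b, potential a b σ x * τ x

/-- The electrostatic energy of a real charge density on the disc. -/
def energy (a b : ℝ) (σ : Plane → ℝ) : ℝ := mutualEnergy a b σ σ

/-- The affine density `α₀ + α₁ x₁ / a + α₂ x₂ / b`. -/
def affineDensity (a b : ℝ) (α : Fin 3 → ℝ) (x : Plane) : ℝ :=
  α 0 + α 1 * x 0 / a + α 2 * x 1 / b

/-- The densities `σ₀ = 1`, `σ₁ = x₁ / a`, `σ₂ = x₂ / b`. -/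
def basicDensity (a b : ℝ) (i : Fin 3) : Plane → ℝ :=
  ![fun _ => 1, fun x => x 0 / a, fun x => x 1 / b] i

end EllipticDisc

end

noncomputable section

namespace EllipticDisc

/-! A pair of points of the disc is described by the line through them and their positions on it. In
coordinates scaled by `a` and `b`, with line `y = m x + c` and abscissae `x, x'`, the Jacobian is
`(a b)² |x' - x|` and the distance is `|x' - x| √(a² + b² m²)`. The singularity of the kernel
therefore cancels exactly (`indicator_comp_linePair`), and the energy becomes an integral over lines
of a product of two chord integrals (`setIntegral_prod_eq_integral_chordIntegral`).

Each chord integral of an affine density is elementary (`integral_chord`), and integrating over `c`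
leaves a function of the slope alone (`integral_chord_mul_chord`). Putting `m = tan θ` turns that
into `K` and `E` (`integral_slope`). The whole computation is bilinear in two densities, so cross
terms and separate energies are special cases of `mutualEnergy_affineDensity`. -/

/-! ### Change of variables from pairs of points to lines -/

theorem lintegral_eq_lintegral_comp_mul_left {t : ℝ} (ht : t ≠ 0) {g : ℝ → ENNReal}
    (hg : Measurable g) : ∫⁻ x, g x = ∫⁻ x, ENNReal.ofReal |t| * g (t * x) := by
  conv_lhs => rw [← Real.smul_map_volume_mul_left ht]
  rw [lintegral_smul_measure, lintegral_map hg (by fun_prop), lintegral_const_mul _ (by fun_prop),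
    smul_eq_mul]

theorem measurable_vec {α : Type*} [MeasurableSpace α] {f g : α → ℝ} (hf : Measurable f)
    (hg : Measurable g) :
    Measurable fun x => (!₂[f x, g x] : Plane) := by
  refine (WithLp.measurable_toLp 2 (Fin 2 → ℝ)).comp (measurable_pi_iff.2 fun i => ?_)
  fin_cases i
  · simpa using hf
  · simpa using hg

theorem lintegral_plane_eq {a b : ℝ} (ha : 0 < a) (hb : 0 < b) {H : Plane → ENNReal}
    (hH : Measurable H) :
    ∫⁻ p, H p = ∫⁻ x : ℝ, ∫⁻ y : ℝ, ENNReal.ofReal (a * b) * H !₂[a * x, b * y] := by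
  have hm : Measurable fun z : ℝ × ℝ => H !₂[z.1, z.2] :=
    hH.comp (measurable_vec measurable_fst measurable_snd)
  have h1 : ∫⁻ p, H p = ∫⁻ z : ℝ × ℝ, H !₂[z.1, z.2] := by
    have e := ((EuclideanSpace.volume_preserving_symm_measurableEquiv_toLp (Fin 2)).trans
      (volume_preserving_finTwoArrow ℝ))
    rw [← e.lintegral_comp hm]
    refine lintegral_congr fun p => congrArg H ?_
    ext i
    fin_cases i <;> rfl
  rw [h1, Measure.volume_eq_prod, lintegral_prod _ hm.aemeasurable,
    lintegral_eq_lintegral_comp_mul_left ha.ne' hm.lintegral_prod_right']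
  refine lintegral_congr fun x => ?_
  have h2 : Measurable fun y : ℝ => H !₂[a * x, y] :=
    hH.comp (measurable_vec measurable_const measurable_id)
  rw [lintegral_eq_lintegral_comp_mul_left hb.ne' h2, ← lintegral_const_mul]
  · refine lintegral_congr fun y => ?_
    rw [abs_of_pos ha, abs_of_pos hb, ENNReal.ofReal_mul ha.le, mul_assoc]
  · exact (h2.comp (measurable_const_mul b)).const_mul _

/-- Ordinates `y, y'` at two distinct abscissae `x, x'` are parametrized by the line through the
two points. -/
theorem lintegral_lintegral_eq_line {x x' : ℝ} (hx : x' ≠ x) {h : ℝ → ℝ → ENNReal}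
    (hh : Measurable (Function.uncurry h)) :
    ∫⁻ y, ∫⁻ y', h y y' =
      ∫⁻ m, ∫⁻ c, ENNReal.ofReal |x' - x| * h (m * x + c) (m * x' + c) := by
  have key {α : Type} [MeasurableSpace α] {f g : α → ℝ} (hf : Measurable f) (hg : Measurable g) :
      Measurable fun z => h (f z) (g z) := hh.comp (hf.prodMk hg)
  have hx' : x' - x ≠ 0 := sub_ne_zero.2 hx
  calc ∫⁻ y, ∫⁻ y', h y y'
      = ∫⁻ y, ∫⁻ m, ENNReal.ofReal |x' - x| * h y (y + (x' - x) * m) := by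
        refine lintegral_congr fun y => ?_
        rw [← lintegral_add_left_eq_self _ y, lintegral_eq_lintegral_comp_mul_left hx']
        exact key (by fun_prop) (by fun_prop)
    _ = ∫⁻ m, ∫⁻ y, ENNReal.ofReal |x' - x| * h y (y + (x' - x) * m) := by
        refine lintegral_lintegral_swap (Measurable.aemeasurable ?_)
        exact (key (by fun_prop) (by fun_prop)).const_mul _
    _ = _ := by
        refine lintegral_congr fun m => ?_
        -- Shifting `y` by `m * x` replaces the ordinate at `x` by the intercept `c`.
        rw [← lintegral_add_left_eq_self _ (m * x)]
        refine lintegral_congr fun c => ?_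
        congr 2
        ring

/-- The pair of points with scaled abscissae `x`, `x'` on the line of slope `m` and ordinate `c`. -/
def linePair (a b : ℝ) (w : (ℝ × ℝ) × (ℝ × ℝ)) : Plane × Plane :=
  (!₂[a * w.2.1, b * (w.1.1 * w.2.1 + w.1.2)], !₂[a * w.2.2, b * (w.1.1 * w.2.2 + w.1.2)])

theorem measurable_linePair (a b : ℝ) : Measurable (linePair a b) :=
  (measurable_vec (by fun_prop) (by fun_prop)).prodMk (measurable_vec (by fun_prop) (by fun_prop))

/-- Working with `ENNReal`-valued functions lets Tonelli reorder the four integrals with no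
integrability condition. -/
theorem lintegral_prod_eq_linePair {a b : ℝ} (ha : 0 < a) (hb : 0 < b)
    {H : Plane × Plane → ENNReal} (hH : Measurable H) :
    ∫⁻ p, H p =
      ∫⁻ w, ENNReal.ofReal ((a * b) ^ 2 * |w.2.2 - w.2.1|) * H (linePair a b w) := by
  have hab : 0 < a * b := mul_pos ha hb
  have key {α : Type} [MeasurableSpace α] {f g k l : α → ℝ} (hf : Measurable f) (hg : Measurable g)
      (hk : Measurable k) (hl : Measurable l) :
      Measurable fun z => H (!₂[f z, g z], !₂[k z, l z]) :=
    hH.comp ((measurable_vec hf hg).prodMk (measurable_vec hk hl))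
  have hG : Measurable fun w : (ℝ × ℝ) × (ℝ × ℝ) =>
      ENNReal.ofReal ((a * b) ^ 2 * |w.2.2 - w.2.1|) * H (linePair a b w) :=
    (Measurable.ennreal_ofReal (by fun_prop)).mul (hH.comp (measurable_linePair a b))
  calc ∫⁻ p, H p = ∫⁻ p, ∫⁻ q, H (p, q) := by
        rw [Measure.volume_eq_prod, lintegral_prod _ hH.aemeasurable]
    _ = ∫⁻ x : ℝ, ∫⁻ y : ℝ, ∫⁻ x' : ℝ, ∫⁻ y' : ℝ, ENNReal.ofReal (a * b) *
          (ENNReal.ofReal (a * b) * H (!₂[a * x, b * y], !₂[a * x', b * y'])) := by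
        rw [lintegral_plane_eq ha hb hH.lintegral_prod_right']
        refine lintegral_congr fun x => lintegral_congr fun y => ?_
        rw [lintegral_plane_eq ha hb (by fun_prop), ← lintegral_const_mul' _ _ (by simp)]
        refine lintegral_congr fun x' => ?_
        rw [lintegral_const_mul' _ _ ENNReal.ofReal_ne_top,
          lintegral_const_mul' _ _ ENNReal.ofReal_ne_top,
          lintegral_const_mul' _ _ ENNReal.ofReal_ne_top]
    _ = ∫⁻ x : ℝ, ∫⁻ x' : ℝ, ∫⁻ y : ℝ, ∫⁻ y' : ℝ, ENNReal.ofReal (a * b) *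
          (ENNReal.ofReal (a * b) * H (!₂[a * x, b * y], !₂[a * x', b * y'])) := by
        refine lintegral_congr fun x => lintegral_lintegral_swap (Measurable.aemeasurable ?_)
        exact Measurable.lintegral_prod_right' (f := fun z : (ℝ × ℝ) × ℝ => ENNReal.ofReal (a * b) *
          (ENNReal.ofReal (a * b) * H (!₂[a * x, b * z.1.1], !₂[a * z.1.2, b * z.2])))
          (((key (by fun_prop) (by fun_prop) (by fun_prop) (by fun_prop)).const_mul _).const_mul _)
    _ = ∫⁻ x : ℝ, ∫⁻ x' : ℝ, ∫⁻ m : ℝ, ∫⁻ c : ℝ,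
          ENNReal.ofReal ((a * b) ^ 2 * |x' - x|) * H (linePair a b ((m, c), (x, x'))) := by
        refine lintegral_congr fun x => lintegral_congr_ae ?_
        -- Pairs on a vertical line have no slope, but they form a null set.
        filter_upwards [Measure.ae_ne volume x] with x' hx
        rw [lintegral_lintegral_eq_line hx
          (((key (by fun_prop) (by fun_prop) (by fun_prop) (by fun_prop)).const_mul _).const_mul _)]
        refine lintegral_congr fun m => lintegral_congr fun c => ?_
        rw [ENNReal.ofReal_mul (sq_nonneg _), ENNReal.ofReal_pow hab.le, linePair]
        ring
    _ = ∫⁻ x : ℝ, ∫⁻ x' : ℝ, ∫⁻ s : ℝ × ℝ,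
          ENNReal.ofReal ((a * b) ^ 2 * |x' - x|) * H (linePair a b (s, (x, x'))) := by
        refine lintegral_congr fun x => lintegral_congr fun x' => ?_
        rw [Measure.volume_eq_prod, lintegral_prod _ (Measurable.aemeasurable ?_)]
        exact hG.comp (f := fun s : ℝ × ℝ => (s, (x, x'))) (measurable_id.prodMk measurable_const)
    _ = ∫⁻ t : ℝ × ℝ, ∫⁻ s : ℝ × ℝ,
          ENNReal.ofReal ((a * b) ^ 2 * |t.2 - t.1|) * H (linePair a b (s, t)) := by
        conv_rhs => rw [Measure.volume_eq_prod]
        exact (lintegral_prod _ (hG.lintegral_prod_left').aemeasurable).symm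
    _ = _ := by
        conv_rhs => rw [Measure.volume_eq_prod, lintegral_prod_symm _ hG.aemeasurable]

/-- As an identity of measures, the change of variables transfers both integrability and values of
real integrals. -/
theorem map_linePair {a b : ℝ} (ha : 0 < a) (hb : 0 < b) :
    Measure.map (linePair a b) (volume.withDensity fun w : (ℝ × ℝ) × (ℝ × ℝ) =>
      ((Real.toNNReal ((a * b) ^ 2 * |w.2.2 - w.2.1|) : NNReal) : ENNReal)) = volume := by
  refine Measure.ext_of_lintegral _ fun H hH => ?_
  rw [lintegral_map hH (measurable_linePair a b),
    lintegral_withDensity_eq_lintegral_mul (g := fun w => H (linePair a b w)) _ (by fun_prop)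
      (hH.comp (measurable_linePair a b)),
    lintegral_prod_eq_linePair ha hb hH]
  rfl

theorem integrable_comp_linePair {a b : ℝ} (ha : 0 < a) (hb : 0 < b) {H : Plane × Plane → ℝ}
    (hH : Integrable H) :
    Integrable fun w => (a * b) ^ 2 * |w.2.2 - w.2.1| * H (linePair a b w) := by
  have hm := hH.1
  rw [← map_linePair ha hb] at hm
  rw [← map_linePair ha hb, integrable_map_measure hm (measurable_linePair a b).aemeasurable,
    integrable_withDensity_iff_integrable_smul (by fun_prop)] at hH
  refine hH.congr (Filter.Eventually.of_forall fun w => ?_)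
  simp only [Function.comp, NNReal.smul_def, smul_eq_mul]
  rw [Real.coe_toNNReal _ (by positivity)]

theorem integral_eq_integral_linePair {a b : ℝ} (ha : 0 < a) (hb : 0 < b)
    {H : Plane × Plane → ℝ} (hH : Integrable H) :
    ∫ p, H p = ∫ w, (a * b) ^ 2 * |w.2.2 - w.2.1| * H (linePair a b w) := by
  conv_lhs => rw [← map_linePair ha hb]
  rw [integral_map (measurable_linePair a b).aemeasurable
    (by rw [map_linePair ha hb]; exact hH.1),
    integral_withDensity_eq_integral_smul (by fun_prop)]
  refine integral_congr_ae (Filter.Eventually.of_forall fun w => ?_)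
  simp only [NNReal.smul_def, smul_eq_mul]
  rw [Real.coe_toNNReal _ (by positivity)]

/-! ### Absolute convergence and Fubini -/

theorem measurableSet_disc (a b : ℝ) : MeasurableSet (disc a b) :=
  measurableSet_lt (by fun_prop) measurable_const

theorem norm_le_of_mem_disc {a b : ℝ} (hb : 0 < b) (hab : b < a) {x : Plane} (hx : x ∈ disc a b) :
    ‖x‖ ≤ a := by
  have ha : 0 < a := hb.trans hab
  have h : x 0 ^ 2 / a ^ 2 + x 1 ^ 2 / b ^ 2 - 1 < 0 := hx
  rw [EuclideanSpace.norm_eq]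
  refine Real.sqrt_le_iff.2 ⟨ha.le, ?_⟩
  simp only [Fin.sum_univ_two, Real.norm_eq_abs, sq_abs]
  have h1 : x 1 ^ 2 / a ^ 2 ≤ x 1 ^ 2 / b ^ 2 := by gcongr
  have h2 : (x 0 ^ 2 + x 1 ^ 2) / a ^ 2 ≤ 1 := by rw [add_div]; linarith
  rwa [div_le_one (by positivity)] at h2

theorem abs_affineDensity_le {a b : ℝ} (α : Fin 3 → ℝ) {x : Plane}
    (hx : x ∈ disc a b) : |affineDensity a b α x| ≤ |α 0| + |α 1| + |α 2| := by
  have h : x 0 ^ 2 / a ^ 2 + x 1 ^ 2 / b ^ 2 - 1 < 0 := hx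
  rw [← div_pow, ← div_pow] at h
  have h0 : |x 0 / a| ≤ 1 := abs_le_one_iff_mul_self_le_one.2 (by nlinarith [sq_nonneg (x 1 / b)])
  have h1 : |x 1 / b| ≤ 1 := abs_le_one_iff_mul_self_le_one.2 (by nlinarith [sq_nonneg (x 0 / a)])
  rw [affineDensity, mul_div_assoc, mul_div_assoc]
  refine (abs_add_three _ _ _).trans ?_
  rw [abs_mul, abs_mul]
  gcongr
  · exact mul_le_of_le_one_right (abs_nonneg _) h0
  · exact mul_le_of_le_one_right (abs_nonneg _) h1

theorem measurable_affineDensity (a b : ℝ) (α : Fin 3 → ℝ) : Measurable (affineDensity a b α) := by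
  unfold affineDensity
  fun_prop

/-- The Newtonian kernel, cut off at distance `R`. -/
def cutKernel (R : ℝ) : Plane → ℝ := (Metric.ball 0 R).indicator fun z => ‖z‖⁻¹

theorem integrable_cutKernel (R : ℝ) : Integrable (cutKernel R) := by
  refine (IntegrableOn.integrable_indicator ?_ measurableSet_ball)
  rw [integrableOn_fun_norm_addHaar volume (f := fun r : ℝ => r⁻¹)]
  refine ((integrableOn_const (C := (1 : ℝ)) (s := Set.Ioo 0 R) (by simp))).congr_fun
    (fun y hy => ?_) measurableSet_Ioo
  have : y ≠ 0 := hy.1.ne'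
  simp [this]

/-- Two points of the disc are at distance at most `2 * a`; the extra `1` puts their difference
inside the open ball. -/
theorem cutKernel_sub {a b : ℝ} (hb : 0 < b) (hab : b < a) {x y : Plane} (hx : x ∈ disc a b)
    (hy : y ∈ disc a b) : cutKernel (2 * a + 1) (x - y) = ‖x - y‖⁻¹ := by
  refine Set.indicator_of_mem ?_ _
  rw [mem_ball_zero_iff]
  linarith [norm_sub_le x y, norm_le_of_mem_disc hb hab hx, norm_le_of_mem_disc hb hab hy]

theorem integrableOn_affineDensity_div {a b : ℝ} (hb : 0 < b) (hab : b < a) (α : Fin 3 → ℝ)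
    {x : Plane} (hx : x ∈ disc a b) :
    IntegrableOn (fun y : Plane => affineDensity a b α y / ‖x - y‖) (disc a b) := by
  have h : IntegrableOn (fun y => affineDensity a b α y * cutKernel (2 * a + 1) (x - y))
      (disc a b) := by
    refine Integrable.bdd_mul (c := |α 0| + |α 1| + |α 2|)
      ((integrable_cutKernel _).comp_sub_left x).integrableOn
      (measurable_affineDensity a b α).aestronglyMeasurable ?_
    filter_upwards [ae_restrict_mem (measurableSet_disc a b)] with y hy
    exact abs_affineDensity_le α hy
  refine h.congr_fun (fun y hy => ?_) (measurableSet_disc a b)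
  simp only [cutKernel_sub hb hab hx hy, div_eq_mul_inv]

theorem integrableOn_const_disc {a b : ℝ} (hb : 0 < b) (hab : b < a) (c : ℝ) :
    IntegrableOn (fun _ => c) (disc a b) := by
  refine integrableOn_const (ne_top_of_le_ne_top
    (measure_closedBall_lt_top (μ := volume) (x := (0 : Plane)) (r := a)).ne (measure_mono ?_))
  exact fun x hx => mem_closedBall_zero_iff.2 (norm_le_of_mem_disc hb hab hx)

theorem integrableOn_prod_div {a b : ℝ} (hb : 0 < b) (hab : b < a) (β γ : Fin 3 → ℝ) :
    IntegrableOn (fun p : Plane × Plane =>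
      affineDensity a b β p.1 * affineDensity a b γ p.2 / ‖p.1 - p.2‖)
      (disc a b ×ˢ disc a b) := by
  have hs := (measurableSet_disc a b).prod (measurableSet_disc a b)
  have h1 : Integrable ((disc a b).indicator fun _ : Plane => (1 : ℝ)) :=
    (integrableOn_const_disc hb hab 1).integrable_indicator (measurableSet_disc a b)
  -- The integrand of a convolution of two `L¹` functions is integrable on the product; the
  -- densities then enter as bounded factors.
  have h2 := (h1.convolution_integrand (ContinuousLinearMap.mul ℝ ℝ)
    (integrable_cutKernel (2 * a + 1))).integrableOn (s := disc a b ×ˢ disc a b)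
  have h3 : IntegrableOn (fun p : Plane × Plane => affineDensity a b β p.1 *
      affineDensity a b γ p.2 * ((disc a b).indicator (fun _ : Plane => (1 : ℝ)) p.2 *
        cutKernel (2 * a + 1) (p.1 - p.2))) (disc a b ×ˢ disc a b) := by
    refine Integrable.bdd_mul (c := (|β 0| + |β 1| + |β 2|) * (|γ 0| + |γ 1| + |γ 2|)) h2
      (((measurable_affineDensity a b β).comp measurable_fst).mul
        ((measurable_affineDensity a b γ).comp measurable_snd)).aestronglyMeasurable ?_
    filter_upwards [ae_restrict_mem hs] with p hp
    rw [norm_mul]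
    exact mul_le_mul (abs_affineDensity_le β hp.1)
      (abs_affineDensity_le γ hp.2) (abs_nonneg _) (by positivity)
  refine h3.congr_fun (fun p hp => ?_) hs
  simp only [cutKernel_sub hb hab hp.1 hp.2, div_eq_mul_inv, Set.indicator_of_mem hp.2, one_mul]

theorem mutualEnergy_eq_setIntegral_prod {a b : ℝ} (hb : 0 < b) (hab : b < a) (β γ : Fin 3 → ℝ) :
    mutualEnergy a b (affineDensity a b β) (affineDensity a b γ) =
      1 / (4 * Real.pi) * ∫ p in disc a b ×ˢ disc a b,
        affineDensity a b γ p.1 * affineDensity a b β p.2 / ‖p.1 - p.2‖ := by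
  have h := integrableOn_prod_div hb hab γ β
  rw [Measure.volume_eq_prod] at h ⊢
  rw [setIntegral_prod _ h, mutualEnergy, ← integral_const_mul]
  refine integral_congr_ae (Filter.Eventually.of_forall fun x => ?_)
  simp only [potential]
  simp_rw [mul_div_assoc]
  rw [integral_const_mul]
  ring

/-! ### Integrals along a chord and over parallel chords -/

theorem mem_disc_vec {a b : ℝ} (ha : a ≠ 0) (hb : b ≠ 0) (x y : ℝ) :
    (!₂[a * x, b * y] : Plane) ∈ disc a b ↔ x ^ 2 + y ^ 2 < 1 := by
  have : (a * x) ^ 2 / a ^ 2 + (b * y) ^ 2 / b ^ 2 = x ^ 2 + y ^ 2 := by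
    field_simp
  simp [disc, this]

theorem affineDensity_vec {a b : ℝ} (ha : a ≠ 0) (hb : b ≠ 0) (α : Fin 3 → ℝ) (x y : ℝ) :
    affineDensity a b α !₂[a * x, b * y] = α 0 + α 1 * x + α 2 * y := by
  simp only [affineDensity]
  simp
  field_simp

/-- Half the length of the projection to the first axis of the chord cut by the unit disc out of
the line `y = m x + c`. -/
def halfChord (m c : ℝ) : ℝ := Real.sqrt (1 + m ^ 2 - c ^ 2) / (1 + m ^ 2)

theorem line_mem_unitDisc_iff (m c x : ℝ) : x ^ 2 + (m * x + c) ^ 2 < 1 ↔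
    x ∈ Set.Ioo (-(m * c / (1 + m ^ 2)) - halfChord m c) (-(m * c / (1 + m ^ 2)) + halfChord m c) := by
  have hw : 0 < 1 + m ^ 2 := by positivity
  have h1 : x ∈ Set.Ioo (-(m * c / (1 + m ^ 2)) - halfChord m c)
      (-(m * c / (1 + m ^ 2)) + halfChord m c) ↔ |(1 + m ^ 2) * x + m * c| <
        Real.sqrt (1 + m ^ 2 - c ^ 2) := by
    have e : -(m * c / (1 + m ^ 2)) = (-(m * c)) / (1 + m ^ 2) := by ring
    rw [Set.mem_Ioo, abs_lt, halfChord, e, ← sub_div, ← add_div, div_lt_iff₀ hw, lt_div_iff₀ hw]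
    constructor <;> rintro ⟨h, h'⟩ <;> constructor <;> linarith
  rw [h1, Real.lt_sqrt (abs_nonneg _), sq_abs]
  have e : ((1 + m ^ 2) * x + m * c) ^ 2 =
      (1 + m ^ 2) * (x ^ 2 + (m * x + c) ^ 2 - 1) + (1 + m ^ 2 - c ^ 2) := by ring
  rw [e]
  constructor <;> intro h <;> nlinarith

/-- An affine function integrates over an interval to its length times the value at the midpoint,
here `x₀ = -m c / (1 + m²)`. -/
theorem integral_chord {a b : ℝ} (ha : a ≠ 0) (hb : b ≠ 0) (α : Fin 3 → ℝ) (m c : ℝ) :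
    ∫ x : ℝ, (disc a b).indicator (affineDensity a b α) !₂[a * x, b * (m * x + c)] =
      2 * halfChord m c * (α 0 + (α 2 - α 1 * m) * c / (1 + m ^ 2)) := by
  have hw : 1 + m ^ 2 ≠ 0 := by positivity
  have hh : 0 ≤ halfChord m c := by unfold halfChord; positivity
  set x₀ := -(m * c / (1 + m ^ 2)) with hx₀
  have h : (fun x : ℝ => (disc a b).indicator (affineDensity a b α) !₂[a * x, b * (m * x + c)]) =
      (Set.Ioo (x₀ - halfChord m c) (x₀ + halfChord m c)).indicator
        fun x => (α 0 + α 2 * c) + (α 1 + α 2 * m) * x := by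
    funext x
    by_cases hx : x ∈ Set.Ioo (x₀ - halfChord m c) (x₀ + halfChord m c)
    · rw [Set.indicator_of_mem hx, Set.indicator_of_mem
        ((mem_disc_vec ha hb _ _).2 ((line_mem_unitDisc_iff m c x).2 hx)), affineDensity_vec ha hb]
      ring
    · rw [Set.indicator_of_notMem hx, Set.indicator_of_notMem]
      rwa [mem_disc_vec ha hb, line_mem_unitDisc_iff]
  rw [h, integral_indicator measurableSet_Ioo, ← integral_Ioc_eq_integral_Ioo,
    ← intervalIntegral.integral_of_le (by linarith), intervalIntegral.integral_add (by simp)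
      (by apply Continuous.intervalIntegrable; fun_prop), intervalIntegral.integral_const,
    intervalIntegral.integral_const_mul, integral_id, smul_eq_mul]
  have e : (α 2 - α 1 * m) * c / (1 + m ^ 2) = α 2 * c + (α 1 + α 2 * m) * x₀ := by
    rw [hx₀]; field_simp; ring
  rw [e]
  ring

/-- The two chord lengths multiply the square root by itself, so the integrand is a polynomial in
`c` for `c² ≤ 1 + m²`; its odd terms integrate to zero. -/
theorem integral_chord_mul_chord (m p q r s : ℝ) :
    ∫ c : ℝ, (2 * halfChord m c * (p + q * c / (1 + m ^ 2))) *
        (2 * halfChord m c * (r + s * c / (1 + m ^ 2))) =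
      16 / 3 * (p * r) / Real.sqrt (1 + m ^ 2) +
        16 / 15 * (q * s) / Real.sqrt (1 + m ^ 2) ^ 3 := by
  have hw : 0 < 1 + m ^ 2 := by positivity
  set w := Real.sqrt (1 + m ^ 2) with hwdef
  have hw0 : 0 < w := Real.sqrt_pos.2 hw
  have hw2 : 1 + m ^ 2 = w ^ 2 := (Real.sq_sqrt hw.le).symm
  have h : (fun c : ℝ => (2 * halfChord m c * (p + q * c / (1 + m ^ 2))) *
        (2 * halfChord m c * (r + s * c / (1 + m ^ 2)))) =
      (Set.Ioc (-w) w).indicator fun c => 4 / w ^ 8 * ((w ^ 2 - c ^ 2) *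
        ((p * w ^ 2 + q * c) * (r * w ^ 2 + s * c))) := by
    funext c
    simp only [halfChord, hw2]
    by_cases hc : c ∈ Set.Ioc (-w) w
    · rw [Set.indicator_of_mem hc]
      have : 0 ≤ w ^ 2 - c ^ 2 := sub_nonneg.2 (sq_le_sq' hc.1.le hc.2)
      have e : w ^ 2 - c ^ 2 = Real.sqrt (w ^ 2 - c ^ 2) ^ 2 := (Real.sq_sqrt this).symm
      generalize Real.sqrt (w ^ 2 - c ^ 2) = t at e ⊢
      rw [e]
      field_simp
      ring
    · rw [Set.indicator_of_notMem hc]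
      -- Lines missing the disc contribute nothing, since `Real.sqrt` vanishes on nonpositive
      -- numbers.
      have : w ^ 2 - c ^ 2 ≤ 0 := by
        rw [Set.mem_Ioc, not_and_or, not_lt, not_le] at hc
        rcases hc with hc | hc <;> nlinarith
      simp [Real.sqrt_eq_zero_of_nonpos this]
  have e : ∀ c : ℝ, (w ^ 2 - c ^ 2) * ((p * w ^ 2 + q * c) * (r * w ^ 2 + s * c)) =
      p * r * w ^ 6 + (p * s + q * r) * w ^ 4 * c ^ 1 + (q * s * w ^ 2 - p * r * w ^ 4) * c ^ 2 -
        (p * s + q * r) * w ^ 2 * c ^ 3 - q * s * c ^ 4 := fun c => by ring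
  rw [h, integral_indicator measurableSet_Ioc, ← intervalIntegral.integral_of_le (by linarith),
    intervalIntegral.integral_const_mul]
  simp_rw [e]
  rw [intervalIntegral.integral_sub, intervalIntegral.integral_sub, intervalIntegral.integral_add,
    intervalIntegral.integral_add, intervalIntegral.integral_const,
    intervalIntegral.integral_const_mul, intervalIntegral.integral_const_mul,
    intervalIntegral.integral_const_mul, intervalIntegral.integral_const_mul,
    integral_pow, integral_pow, integral_pow, integral_pow, smul_eq_mul]
  · field_simp
    ring
  all_goals exact Continuous.intervalIntegrable (by fun_prop) _ _

/-! ### The slope integral and the elliptic integrals -/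

theorem eccentricity_sq {a b : ℝ} (hb : 0 < b) (hab : b < a) :
    eccentricity a b ^ 2 = 1 - b ^ 2 / a ^ 2 := by
  have ha : 0 < a := hb.trans hab
  refine Real.sq_sqrt (sub_nonneg.2 ?_)
  rw [div_le_one (by positivity)]
  gcongr

theorem eccentricity_sq_pos {a b : ℝ} (hb : 0 < b) (hab : b < a) : 0 < eccentricity a b ^ 2 := by
  have ha : 0 < a := hb.trans hab
  rw [eccentricity_sq hb hab, sub_pos, div_lt_one (by positivity)]
  gcongr

theorem one_sub_eccentricity_sq_mul_sin_sq_pos {a b : ℝ} (hb : 0 < b) (hab : b < a) (θ : ℝ) :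
    0 < 1 - eccentricity a b ^ 2 * Real.sin θ ^ 2 := by
  have ha : 0 < a := hb.trans hab
  have h0 := eccentricity_sq_pos hb hab
  have h1 : eccentricity a b ^ 2 < 1 := by
    rw [eccentricity_sq hb hab]
    have : 0 < b ^ 2 / a ^ 2 := by positivity
    linarith
  nlinarith [Real.sin_sq_le_one θ]

theorem integral_eq_integral_tan (g : ℝ → ℝ) :
    ∫ m, g m = ∫ θ in (-(Real.pi / 2))..(Real.pi / 2), 1 / Real.cos θ ^ 2 * g (Real.tan θ) := by
  rw [← setIntegral_univ, ← Real.image_tan_Ioo, integral_image_eq_integral_abs_deriv_smul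
    measurableSet_Ioo (f' := fun θ => 1 / Real.cos θ ^ 2)
    (fun θ hθ => (Real.hasDerivAt_tan (Real.cos_pos_of_mem_Ioo hθ).ne').hasDerivWithinAt)
    Real.injOn_tan, intervalIntegral.integral_of_le (by linarith [Real.pi_pos]),
    integral_Ioc_eq_integral_Ioo]
  refine integral_congr_ae (Filter.Eventually.of_forall fun θ => ?_)
  simp only [smul_eq_mul]
  rw [abs_of_nonneg (by positivity)]

theorem intervalIntegral_symm_eq {f : ℝ → ℝ} (hf : Continuous f) (t : ℝ) :
    ∫ θ in (-t)..t, f θ = ∫ θ in (0 : ℝ)..t, (f θ + f (-θ)) := by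
  have hn : Continuous fun θ => f (-θ) := hf.comp continuous_neg
  rw [intervalIntegral.integral_add (hf.intervalIntegrable _ _) (hn.intervalIntegrable _ _),
    intervalIntegral.integral_comp_neg, neg_zero,
    add_comm, intervalIntegral.integral_add_adjacent_intervals (hf.intervalIntegrable _ _)
    (hf.intervalIntegrable _ _)]

theorem integral_slope {a b : ℝ} (hb : 0 < b) (hab : b < a) (β γ : Fin 3 → ℝ) :
    ∫ m : ℝ, 1 / Real.sqrt (a ^ 2 + b ^ 2 * m ^ 2) *
      (16 / 3 * (β 0 * γ 0) / Real.sqrt (1 + m ^ 2) +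
        16 / 15 * ((β 2 - β 1 * m) * (γ 2 - γ 1 * m)) / Real.sqrt (1 + m ^ 2) ^ 3) =
      2 / a * (16 / 3 * (β 0 * γ 0) * ellipticK (eccentricity a b) +
        16 / 15 * (β 2 * γ 2 * ellipticK (eccentricity a b) + (β 1 * γ 1 - β 2 * γ 2) *
          ((ellipticK (eccentricity a b) - ellipticE (eccentricity a b)) /
            eccentricity a b ^ 2))) := by
  have ha : 0 < a := hb.trans hab
  set ε := eccentricity a b with hε
  have hε0 : 0 < ε ^ 2 := eccentricity_sq_pos hb hab
  have hΔ := one_sub_eccentricity_sq_mul_sin_sq_pos hb hab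
  rw [← hε] at hΔ
  have hΔ' : ∀ θ, Real.sqrt (1 - ε ^ 2 * Real.sin θ ^ 2) ≠ 0 := fun θ =>
    (Real.sqrt_pos.2 (hΔ θ)).ne'
  set G : ℝ → ℝ := fun θ => 1 / a * (1 / Real.sqrt (1 - ε ^ 2 * Real.sin θ ^ 2)) *
    (16 / 3 * (β 0 * γ 0) + 16 / 15 * ((β 2 * Real.cos θ - β 1 * Real.sin θ) *
      (γ 2 * Real.cos θ - γ 1 * Real.sin θ))) with hG
  have hGc : Continuous G := by fun_prop (disch := exact hΔ' _)
  rw [integral_eq_integral_tan]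
  have h1 : ∫ θ in (-(Real.pi / 2))..(Real.pi / 2), 1 / Real.cos θ ^ 2 *
      (1 / Real.sqrt (a ^ 2 + b ^ 2 * Real.tan θ ^ 2) *
      (16 / 3 * (β 0 * γ 0) / Real.sqrt (1 + Real.tan θ ^ 2) +
        16 / 15 * ((β 2 - β 1 * Real.tan θ) * (γ 2 - γ 1 * Real.tan θ)) /
          Real.sqrt (1 + Real.tan θ ^ 2) ^ 3)) = ∫ θ in (-(Real.pi / 2))..(Real.pi / 2), G θ := by
    have hle : -(Real.pi / 2) ≤ Real.pi / 2 := by linarith [Real.pi_pos]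
    rw [intervalIntegral.integral_of_le hle, intervalIntegral.integral_of_le hle,
      integral_Ioc_eq_integral_Ioo, integral_Ioc_eq_integral_Ioo]
    refine setIntegral_congr_fun measurableSet_Ioo fun θ hθ => ?_
    have hc : 0 < Real.cos θ := Real.cos_pos_of_mem_Ioo hθ
    have e1 : Real.sqrt (1 + Real.tan θ ^ 2) = 1 / Real.cos θ := by
      rw [Real.sqrt_eq_iff_mul_self_eq_of_pos (by positivity), Real.tan_eq_sin_div_cos]
      field_simp
      linarith [Real.sin_sq_add_cos_sq θ]
    have e2 : Real.sqrt (a ^ 2 + b ^ 2 * Real.tan θ ^ 2) =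
        a * Real.sqrt (1 - ε ^ 2 * Real.sin θ ^ 2) / Real.cos θ := by
      have hpos : 0 < a * Real.sqrt (1 - ε ^ 2 * Real.sin θ ^ 2) / Real.cos θ :=
        div_pos (mul_pos ha (Real.sqrt_pos.2 (hΔ θ))) hc
      rw [Real.sqrt_eq_iff_mul_self_eq_of_pos hpos, ← pow_two, div_pow, mul_pow,
        Real.sq_sqrt (hΔ θ).le, hε, eccentricity_sq hb hab, Real.tan_eq_sin_div_cos]
      field_simp
      rw [Real.cos_sq']
      ring
    simp only [e1, e2, hG]
    rw [Real.tan_eq_sin_div_cos]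
    have := hΔ' θ
    field_simp
  -- Adding the reflected angle removes the `sin θ * cos θ` terms; `sin² θ = (1 - Δ²) / ε²`, with
  -- `Δ` the square root, splits the rest into the integrands of `K` and `E`.
  have h2 : ∀ θ, G θ + G (-θ) =
      2 / a * (16 / 3 * (β 0 * γ 0) + 16 / 15 * (β 2 * γ 2) +
        16 / 15 * (β 1 * γ 1 - β 2 * γ 2) / ε ^ 2) * (1 / Real.sqrt (1 - ε ^ 2 * Real.sin θ ^ 2)) -
      2 / a * (16 / 15 * (β 1 * γ 1 - β 2 * γ 2) / ε ^ 2) *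
        Real.sqrt (1 - ε ^ 2 * Real.sin θ ^ 2) := by
    intro θ
    simp only [hG, Real.sin_neg, Real.cos_neg, neg_sq]
    have e := Real.sq_sqrt (hΔ θ).le
    have hd := hΔ' θ
    generalize Real.sqrt (1 - ε ^ 2 * Real.sin θ ^ 2) = d at e hd ⊢
    have e' : Real.sin θ ^ 2 = (1 - d ^ 2) / ε ^ 2 := by
      rw [eq_div_iff hε0.ne']; linarith
    have e2 : Real.cos θ ^ 2 = 1 - (1 - d ^ 2) / ε ^ 2 := by rw [Real.cos_sq', e']
    have e3 : 1 / a * (1 / d) * (16 / 3 * (β 0 * γ 0) + 16 / 15 *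
        ((β 2 * Real.cos θ - β 1 * Real.sin θ) * (γ 2 * Real.cos θ - γ 1 * Real.sin θ))) +
        1 / a * (1 / d) * (16 / 3 * (β 0 * γ 0) + 16 / 15 *
        ((β 2 * Real.cos θ - β 1 * -Real.sin θ) * (γ 2 * Real.cos θ - γ 1 * -Real.sin θ))) =
        2 / a * (1 / d) * (16 / 3 * (β 0 * γ 0) + 16 / 15 *
        (β 2 * γ 2 * Real.cos θ ^ 2 + β 1 * γ 1 * Real.sin θ ^ 2)) := by ring
    rw [e3, e2, e']
    have hε1 : ε ≠ 0 := fun h => by simp [h] at hε0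
    field_simp
    ring
  rw [h1, intervalIntegral_symm_eq hGc]
  simp_rw [h2]
  rw [intervalIntegral.integral_sub, intervalIntegral.integral_const_mul,
    intervalIntegral.integral_const_mul, ← ellipticK, ← ellipticE]
  · ring
  · exact Continuous.intervalIntegrable (by fun_prop (disch := exact hΔ' _)) _ _
  · exact Continuous.intervalIntegrable (by fun_prop) _ _

/-! ### Reduction of the energy to lines, and its value -/

theorem norm_linePair_sub {a b : ℝ} (w : (ℝ × ℝ) × (ℝ × ℝ)) :
    ‖(linePair a b w).1 - (linePair a b w).2‖ =
      |w.2.2 - w.2.1| * Real.sqrt (a ^ 2 + b ^ 2 * w.1.1 ^ 2) := by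
  rw [EuclideanSpace.norm_eq, ← Real.sqrt_sq_eq_abs, ← Real.sqrt_mul (sq_nonneg _)]
  congr 1
  simp only [linePair, Fin.sum_univ_two, Real.norm_eq_abs, sq_abs]
  simp
  ring

/-- The chord integral of an affine density over the disc along a line. -/
def chordIntegral (a b : ℝ) (α : Fin 3 → ℝ) (s : ℝ × ℝ) : ℝ :=
  ∫ x : ℝ, (disc a b).indicator (affineDensity a b α) !₂[a * x, b * (s.1 * x + s.2)]

theorem indicator_comp_linePair {a b : ℝ} (ha : 0 < a) (β γ : Fin 3 → ℝ)
    {w : (ℝ × ℝ) × (ℝ × ℝ)} (hw : w.2.1 ≠ w.2.2) :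
    (a * b) ^ 2 * |w.2.2 - w.2.1| * (disc a b ×ˢ disc a b).indicator (fun p : Plane × Plane =>
      affineDensity a b β p.1 * affineDensity a b γ p.2 / ‖p.1 - p.2‖) (linePair a b w) =
    (a * b) ^ 2 / Real.sqrt (a ^ 2 + b ^ 2 * w.1.1 ^ 2) *
      ((disc a b).indicator (affineDensity a b β) !₂[a * w.2.1, b * (w.1.1 * w.2.1 + w.1.2)] *
      (disc a b).indicator (affineDensity a b γ) !₂[a * w.2.2, b * (w.1.1 * w.2.2 + w.1.2)]) := by
  have hs : Real.sqrt (a ^ 2 + b ^ 2 * w.1.1 ^ 2) ≠ 0 := (Real.sqrt_pos.2 (by positivity)).ne'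
  have hd : |w.2.2 - w.2.1| ≠ 0 := abs_ne_zero.2 (sub_ne_zero.2 hw.symm)
  have h : ∀ p : Plane × Plane, (disc a b ×ˢ disc a b).indicator (fun p : Plane × Plane =>
      affineDensity a b β p.1 * affineDensity a b γ p.2 / ‖p.1 - p.2‖) p =
      (disc a b).indicator (affineDensity a b β) p.1 *
        (disc a b).indicator (affineDensity a b γ) p.2 / ‖p.1 - p.2‖ := by
    intro p
    by_cases h1 : p.1 ∈ disc a b <;> by_cases h2 : p.2 ∈ disc a b <;>
      simp [Set.indicator, h1, h2]
  rw [h, norm_linePair_sub]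
  simp only [linePair]
  field_simp

theorem ae_fst_ne_snd : ∀ᵐ t : ℝ × ℝ, t.1 ≠ t.2 := by
  rw [Measure.volume_eq_prod]
  refine (Measure.ae_prod_iff_ae_ae (p := fun t : ℝ × ℝ => t.1 ≠ t.2)
    (measurableSet_eq_fun measurable_fst measurable_snd).compl).2
    (Filter.Eventually.of_forall fun x => ?_)
  filter_upwards [Measure.ae_ne volume x] with y hy using hy.symm

theorem setIntegral_prod_eq_integral_chordIntegral {a b : ℝ} (hb : 0 < b) (hab : b < a)
    (β γ : Fin 3 → ℝ) :
    ∫ p in disc a b ×ˢ disc a b,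
        affineDensity a b β p.1 * affineDensity a b γ p.2 / ‖p.1 - p.2‖ =
      ∫ m : ℝ, ∫ c : ℝ, (a * b) ^ 2 / Real.sqrt (a ^ 2 + b ^ 2 * m ^ 2) *
        (chordIntegral a b β (m, c) * chordIntegral a b γ (m, c)) := by
  have ha : 0 < a := hb.trans hab
  have hs := (measurableSet_disc a b).prod (measurableSet_disc a b)
  have hH := (integrableOn_prod_div hb hab β γ).integrable_indicator hs
  have hI := integrable_comp_linePair ha hb hH
  rw [← integral_indicator hs, integral_eq_integral_linePair ha hb hH]
  rw [Measure.volume_eq_prod] at hI ⊢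
  have h : ∀ s : ℝ × ℝ, ∫ t : ℝ × ℝ, (a * b) ^ 2 * |t.2 - t.1| *
      (disc a b ×ˢ disc a b).indicator (fun p : Plane × Plane =>
        affineDensity a b β p.1 * affineDensity a b γ p.2 / ‖p.1 - p.2‖) (linePair a b (s, t)) =
      (a * b) ^ 2 / Real.sqrt (a ^ 2 + b ^ 2 * s.1 ^ 2) *
        (chordIntegral a b β s * chordIntegral a b γ s) := by
    intro s
    rw [chordIntegral, chordIntegral, ← integral_prod_mul, ← integral_const_mul]
    refine integral_congr_ae ?_
    filter_upwards [ae_fst_ne_snd] with t ht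
    exact indicator_comp_linePair (w := (s, t)) ha β γ ht
  -- Integrability over the lines `(m, c)` is inherited from that over pairs, so it needs no
  -- separate estimate.
  have hI' := hI.integral_prod_left
  rw [integral_prod _ hI]
  simp only [h] at hI' ⊢
  rw [Measure.volume_eq_prod] at hI' ⊢
  rw [integral_prod _ hI']

theorem mutualEnergy_affineDensity {a b : ℝ} (hb : 0 < b) (hab : b < a) (β γ : Fin 3 → ℝ) :
    mutualEnergy a b (affineDensity a b β) (affineDensity a b γ) =
      8 * a * b ^ 2 / (15 * Real.pi) *
        ((5 * (β 0 * γ 0) + β 2 * γ 2) * ellipticK (eccentricity a b) +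
          (β 1 * γ 1 - β 2 * γ 2) *
            ((ellipticK (eccentricity a b) - ellipticE (eccentricity a b)) /
              eccentricity a b ^ 2)) := by
  have ha : 0 < a := hb.trans hab
  have hc : ∀ m : ℝ, ∫ c : ℝ, (a * b) ^ 2 / Real.sqrt (a ^ 2 + b ^ 2 * m ^ 2) *
        (chordIntegral a b γ (m, c) * chordIntegral a b β (m, c)) =
      (a * b) ^ 2 * (1 / Real.sqrt (a ^ 2 + b ^ 2 * m ^ 2) *
        (16 / 3 * (γ 0 * β 0) / Real.sqrt (1 + m ^ 2) +
          16 / 15 * ((γ 2 - γ 1 * m) * (β 2 - β 1 * m)) / Real.sqrt (1 + m ^ 2) ^ 3)) := by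
    intro m
    simp only [chordIntegral, integral_chord ha.ne' hb.ne']
    rw [integral_const_mul, integral_chord_mul_chord]
    ring
  rw [mutualEnergy_eq_setIntegral_prod hb hab, setIntegral_prod_eq_integral_chordIntegral hb hab]
  simp only [hc]
  rw [integral_const_mul, integral_slope hb hab]
  field_simp
  ring

theorem basicDensity_eq_affineDensity (a b : ℝ) (i : Fin 3) :
    basicDensity a b i = affineDensity a b (Pi.single i 1) := by
  funext x
  fin_cases i <;> simp [basicDensity, affineDensity]

end EllipticDisc

end

theorem theorem1 (a b : ℝ) (hb : 0 < b) (hab : b < a) (α : Fin 3 → ℝ) :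
    -- the integrals defining the potential and the energy converge absolutely
    (∀ x ∈ EllipticDisc.disc a b,
      IntegrableOn (fun y : EllipticDisc.Plane =>
        EllipticDisc.affineDensity a b α y / ‖x - y‖) (EllipticDisc.disc a b)) ∧
    IntegrableOn (fun p : EllipticDisc.Plane × EllipticDisc.Plane =>
        EllipticDisc.affineDensity a b α p.1 * EllipticDisc.affineDensity a b α p.2 /
          ‖p.1 - p.2‖) (EllipticDisc.disc a b ×ˢ EllipticDisc.disc a b) ∧
    -- the energy is also the double integral of the density against the kernel
    EllipticDisc.energy a b (EllipticDisc.affineDensity a b α) =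
      1 / (4 * Real.pi) *
        ∫ p in EllipticDisc.disc a b ×ˢ EllipticDisc.disc a b,
          EllipticDisc.affineDensity a b α p.1 * EllipticDisc.affineDensity a b α p.2 /
            ‖p.1 - p.2‖ ∧
    -- the value of the energy
    EllipticDisc.energy a b (EllipticDisc.affineDensity a b α) =
      8 * a * b ^ 2 / (15 * Real.pi) *
        ((5 * α 0 ^ 2 + α 2 ^ 2) * EllipticDisc.ellipticK (EllipticDisc.eccentricity a b) +
          (α 1 ^ 2 - α 2 ^ 2) *
            ((EllipticDisc.ellipticK (EllipticDisc.eccentricity a b) -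
                EllipticDisc.ellipticE (EllipticDisc.eccentricity a b)) /
              EllipticDisc.eccentricity a b ^ 2)) ∧
    -- the cross terms vanish
    (∀ i j : Fin 3, i ≠ j →
      EllipticDisc.mutualEnergy a b (EllipticDisc.basicDensity a b i)
        (EllipticDisc.basicDensity a b j) = 0) ∧
    -- the three separate energies
    EllipticDisc.energy a b (EllipticDisc.basicDensity a b 0) =
      8 / (3 * Real.pi) * a * b ^ 2 *
        EllipticDisc.ellipticK (EllipticDisc.eccentricity a b) ∧
    EllipticDisc.energy a b (EllipticDisc.basicDensity a b 1) =
      8 / (15 * Real.pi) * a * b ^ 2 *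
        ((EllipticDisc.ellipticK (EllipticDisc.eccentricity a b) -
            EllipticDisc.ellipticE (EllipticDisc.eccentricity a b)) /
          EllipticDisc.eccentricity a b ^ 2) ∧
    EllipticDisc.energy a b (EllipticDisc.basicDensity a b 2) =
      8 / (15 * Real.pi) * a * b ^ 2 *
        (EllipticDisc.ellipticK (EllipticDisc.eccentricity a b) -
          (EllipticDisc.ellipticK (EllipticDisc.eccentricity a b) -
              EllipticDisc.ellipticE (EllipticDisc.eccentricity a b)) /
            EllipticDisc.eccentricity a b ^ 2) := by
  open EllipticDisc in
  refine ⟨fun x hx => integrableOn_affineDensity_div hb hab α hx,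
    integrableOn_prod_div hb hab α α, mutualEnergy_eq_setIntegral_prod hb hab α α, ?_, ?_, ?_, ?_, ?_⟩
  · rw [energy, mutualEnergy_affineDensity hb hab]
    ring
  · intro i j hij
    rw [basicDensity_eq_affineDensity, basicDensity_eq_affineDensity,
      mutualEnergy_affineDensity hb hab]
    fin_cases i <;> fin_cases j <;> simp at hij ⊢
  all_goals
    rw [energy, basicDensity_eq_affineDensity, mutualEnergy_affineDensity hb hab]
    -- The cancellation lemmas are excluded because they would turn the equation into a disjunction.
    simp [-mul_eq_mul_left_iff, -mul_eq_mul_right_iff]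
    ring
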